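/- Let $G$ be a group, let $U, V \le G$ be subgroups, let $\varphi : U \to V$ be an isomorphism, and let $H = \langle G, t \mid t^{-1}ut = \varphi(u),\ u \in U\rangle$ be the corresponding HNN-extension; regard $G$ and $U$ as subgroups of $H$. A group is called hyperbolic if it has a finite generating set whose Cayley graph is Gromov hyperbolic, i.e. for some $\delta \ge 0$ the word metric satisfies $(x\cdot y)_o \ge \min\{(x\cdot z)_o, (y\cdot z)_o\} - \delta$ for all $x,y,z,o$, where $(x\cdot y)_o = \frac12(|x-o|+|y-o|-|x-y|)$. For a finite generating set $S$ of $H$, a subgroup $K \le H$ is called quasiconvex in $H$ (with respect to $S$) if there is $\varepsilon \ge 0$ such that every geodesic of the Cayley graph $\Gamma(H,S)$ with endpoints in $K$ lies in the $\varepsilon$-neighbourhood of $K$. Suppose that $H$ is hyperbolic, and let $S$ be any finite generating set of $H$. If $U$ is quasiconvex in $H$ with respect to $S$, then $G$ is quasiconvex in $H$ with respect to $S$, and $G$ is hyperbolic (in particular, finitely generated). -/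

import Mathlib

/-- The Gromov product `(x · y)_o = (|x - o| + |y - o| - |x - y|) / 2` with respect to the
path metric of a graph. -/
noncomputable def gromovProduct {V : Type*} (Γ : SimpleGraph V) (x y o : V) : ℝ :=
  ((Γ.dist x o : ℝ) + (Γ.dist y o : ℝ) - (Γ.dist x y : ℝ)) / 2

/-- A connected graph is (Gromov) hyperbolic if its path metric satisfies the four-point
inequality `(x · y)_o ≥ min ((x · z)_o, (y · z)_o) - δ` for some constant `δ ≥ 0`. -/
def IsHyperbolicGraph {V : Type*} (Γ : SimpleGraph V) : Prop :=
  Γ.Connected ∧ ∃ δ : ℝ, 0 ≤ δ ∧ ∀ x y z o : V,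
    min (gromovProduct Γ x z o) (gromovProduct Γ y z o) - δ ≤ gromovProduct Γ x y o

/-- A group is hyperbolic if it has a finite generating set whose Cayley graph is hyperbolic. -/
def IsHyperbolicGroup (G : Type*) [Group G] : Prop :=
  ∃ S : Set G, S.Finite ∧ Subgroup.closure S = ⊤ ∧ IsHyperbolicGraph (SimpleGraph.mulCayley S)

/-- A set `Y` of vertices of a graph is quasiconvex if, for some constant `ε ≥ 0`, every geodesic
(a walk whose length is the distance of its endpoints) with endpoints in `Y` stays
in the `ε`-neighbourhood of `Y`. -/
def IsQuasiconvexSet {V : Type*} (Γ : SimpleGraph V) (Y : Set V) : Prop :=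
  ∃ ε : ℕ, ∀ (x y : V) (p : Γ.Walk x y), x ∈ Y → y ∈ Y → p.length = Γ.dist x y →
    ∀ z ∈ p.support, ∃ u ∈ Y, Γ.dist z u ≤ ε

/-- A subgroup of a group generated by `S` is quasiconvex (with respect to `S`) if it is a
quasiconvex set of vertices of the Cayley graph with respect to `S`. -/
def IsQuasiconvexSubgroup {G : Type*} [Group G] (S : Set G) (U : Subgroup G) : Prop :=
  IsQuasiconvexSet (SimpleGraph.mulCayley S) (U : Set G)

/-- The HNN-extension `⟨G, t ∣ t⁻¹ u t = φ u, u ∈ U⟩`. In `HNNExtension G A B ψ` the relations are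
`t a t⁻¹ = ψ a` for `a ∈ A`, so that here they are `t v t⁻¹ = φ⁻¹ v` for `v ∈ V`. -/
abbrev HNN {G : Type*} [Group G] (U V : Subgroup G) (φ : U ≃* V) : Type _ :=
  HNNExtension G V U φ.symm

/-- The canonical embedding of the base group `G` into the HNN-extension. -/
abbrev HNN.base {G : Type*} [Group G] (U V : Subgroup G) (φ : U ≃* V) : G →* HNN U V φ :=
  HNNExtension.of

/-! Removing the base vertex from the Bass-Serre tree splits it into branches, which correspond to
the possible initial syllables of an element of `H`. A path in the Cayley graph between two elements
of `G` that visits a branch must enter and leave it near one left coset of `U`, which itself lies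
near `G` (`exists_branch_separation`). If the path is a geodesic, its part between these passages
stays close to a geodesic with endpoints in the coset. That geodesic stays close to the coset
because `U` is quasiconvex, hence close to `G` (`isQuasiconvexSubgroup_range_of`).

Hyperbolicity of `G` follows because a quasiconvex subgroup is finitely generated and bi-Lipschitz
embedded (`isHyperbolicGroup_of_isQuasiconvexSubgroup`), and hyperbolicity pulls back along
bi-Lipschitz maps of geodesic spaces (`FourPoint.of_biLipschitz`). The latter rests on the Morse
lemma: geodesics and bi-Lipschitz paths with the same endpoints are uniformly close. The same
pullback makes hyperbolicity independent of the finite generating set. -/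

namespace HNNExtension

variable {G : Type*} [Group G] {A B : Subgroup G} {ψ : A ≃* B}

/-! ### Normal forms and the branches of the Bass-Serre tree -/

namespace NormalWord

variable {d : TransversalPair G A B}

/-- Multiplying a normal word by `t ^ u` preserves its last syllable, unless the word
or the product represents an element of the base group. -/
theorem getLast?_unitsSMul (ψ : A ≃* B) (u : ℤˣ) (w : NormalWord d) :
    (unitsSMul ψ u w).toList.getLast? = w.toList.getLast? ∨
    (∃ r, w.toList = [] ∧ (unitsSMul ψ u w).toList.getLast? = some (u, r) ∧
      w.head * r⁻¹ ∈ toSubgroup A B u) ∨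
    (∃ r, (unitsSMul ψ u w).toList = [] ∧ w.toList.getLast? = some (-u, r) ∧
      (unitsSMul ψ u w).head * r⁻¹ ∈ toSubgroup A B (-u)) := by
  by_cases h : Cancels u w
  · simp only [unitsSMul, h, dite_true]
    cases w using consRecOn with
    | ofGroup => simp [Cancels] at h
    | cons g u' w h1 h2 ih =>
      clear ih
      have hu : u' = -u := by simpa [Cancels] using h.2
      subst hu
      rcases hl : w.toList with _ | ⟨a, l⟩
      · refine Or.inr (Or.inr ⟨w.head, ?_, ?_, ?_⟩)
        · simpa [unitsSMulWithCancel] using hl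
        · simp [hl]
        · simp [unitsSMulWithCancel]
      · left
        simp [unitsSMulWithCancel, hl]
  · simp only [unitsSMul, h, dite_false]
    rcases hl : w.toList with _ | ⟨a, l⟩
    -- Only the subgroup part of the head crosses `t ^ u`; its transversal part `r` stays behind in
    -- the new syllable.
    · refine Or.inr (Or.inl ⟨((d.compl u).equiv w.head).2, rfl, ?_, ?_⟩)
      · simp [hl, unitsSMulGroup]
      · have := (d.compl u).equiv_fst_eq_mul_inv w.head
        rw [← this]
        exact ((d.compl u).equiv w.head).1.2
    · left
      simp [hl]

end NormalWord

open NormalWord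

variable (d : TransversalPair G A B)

/-- The branch at the base vertex of the Bass-Serre tree that contains the vertex of `h`, that is,
the initial syllable of `h`, read off from the normal form of `h⁻¹`. -/
noncomputable def branch (h : HNNExtension G A B ψ) : Option (ℤˣ × G) :=
  (h⁻¹ • (empty : NormalWord d)).toList.getLast?

theorem branch_of (g : G) : branch d (of g : HNNExtension G A B ψ) = none := by
  rw [branch, ← map_inv, of_smul_eq_smul]
  simp

theorem mem_range_of_toList_eq_nil {h : HNNExtension G A B ψ}
    (hh : (h • (empty : NormalWord d)).toList = []) :
    of (h • (empty : NormalWord d)).head = h := by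
  have := prod_smul ψ h (empty : NormalWord d)
  rw [prod_empty, mul_one] at this
  conv_rhs => rw [← this]
  simp [ReducedWord.prod, hh]

theorem mem_range_of_branch_eq_none {h : HNNExtension G A B ψ} (hh : branch d h = none) :
    h ∈ (of : G →* HNNExtension G A B ψ).range := by
  rw [branch, List.getLast?_eq_none_iff] at hh
  have := mem_range_of_toList_eq_nil d hh
  exact ⟨(h⁻¹ • (empty : NormalWord d)).head⁻¹, by rw [map_inv, this, inv_inv]⟩

/-- The edge stabilizer coset of the base group through which the branch `e` is entered. -/
def branchCoset (A B : Subgroup G) (e : ℤˣ × G) : Set G :=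
  {k | k⁻¹ * e.2⁻¹ ∈ toSubgroup A B e.1}

/-- Right multiplication of `h` by `s` is left multiplication of `h⁻¹` by `s⁻¹`. A base element
changes only the head of the normal form, and `t` can change the last syllable only if `h` or `h *
t` lies in the base group. The set `F` depends on `s` alone, which makes the later distance bounds
uniform. -/
theorem exists_finite_mul_mem_branchCoset (s : HNNExtension G A B ψ) :
    ∃ F : Set (HNNExtension G A B ψ), F.Finite ∧ ∀ h e,
      ¬(branch d h = some e ↔ branch d (h * s) = some e) →
      ∃ b ∈ F, ∃ k ∈ branchCoset A B e, h * b = of k := by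
  induction s using HNNExtension.induction_on with
  | of g =>
    refine ⟨∅, Set.finite_empty, fun h e hne => (hne ?_).elim⟩
    rw [branch, branch, mul_inv_rev, mul_smul, ← map_inv, of_smul_eq_smul, group_smul_toList]
  | t =>
    refine ⟨{1, t}, by simp, fun h e hne => ?_⟩
    have key : (t⁻¹ * h⁻¹ : HNNExtension G A B ψ) • (empty : NormalWord d) =
        unitsSMul ψ (-1) (h⁻¹ • (empty : NormalWord d)) := by
      rw [mul_smul, ← t_pow_smul_eq_unitsSMul]
      simp
    rw [branch, branch, mul_inv_rev, key] at hne
    rcases getLast?_unitsSMul ψ (-1) (h⁻¹ • (empty : NormalWord d)) with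
      h1 | ⟨r, h1, h2, h3⟩ | ⟨r, h1, h2, h3⟩
    · rw [h1] at hne
      exact (hne Iff.rfl).elim
    · rw [h1, h2] at hne
      have he : e = (-1, r) := by
        by_contra hc
        apply hne
        simpa using fun h => hc h.symm
      subst he
      refine ⟨1, by simp, (h⁻¹ • (empty : NormalWord d)).head⁻¹, ?_, ?_⟩
      · simpa [branchCoset] using h3
      · rw [map_inv, mem_range_of_toList_eq_nil d h1]
        simp
    · rw [h1, h2] at hne
      have he : e = (- -1, r) := by
        by_contra hc
        apply hne
        simpa using fun h => hc (by rw [← h]; simp)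
      subst he
      rw [← key] at h1 h3
      refine ⟨t, by simp, ((t⁻¹ * h⁻¹) • (empty : NormalWord d)).head⁻¹, ?_, ?_⟩
      · simpa [branchCoset] using h3
      · rw [map_inv, mem_range_of_toList_eq_nil d h1]
        simp
  | mul x y hx hy =>
    obtain ⟨F, hF, hx⟩ := hx
    obtain ⟨F', hF', hy⟩ := hy
    refine ⟨F ∪ (x * ·) '' F', hF.union (hF'.image _), fun h e hne => ?_⟩
    -- The branch `e` is crossed either between `h` and `h * x` or between `h * x` and `h * x * y`.
    by_cases hxe : branch d h = some e ↔ branch d (h * x) = some e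
    · rw [hxe, ← mul_assoc] at hne
      obtain ⟨b, hb, k, hk, hbk⟩ := hy _ _ hne
      exact ⟨x * b, Or.inr ⟨b, hb, rfl⟩, k, hk, by rw [← mul_assoc, hbk]⟩
    · obtain ⟨b, hb, hk⟩ := hx _ _ hxe
      exact ⟨b, Or.inl hb, hk⟩
  | inv x hx =>
    obtain ⟨F, hF, hx⟩ := hx
    refine ⟨(x⁻¹ * ·) '' F, hF.image _, fun h e hne => ?_⟩
    obtain ⟨b, hb, k, hk, hbk⟩ := hx (h * x⁻¹) e (by simpa [iff_comm] using hne)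
    exact ⟨x⁻¹ * b, ⟨b, hb, rfl⟩, k, hk, by rw [← mul_assoc, hbk]⟩

/-- The coset `of '' branchCoset A B e` is a left coset of `B`, up to right multiplication by `1`
or `t`. -/
theorem exists_branchCoset_eq (e : ℤˣ × G) :
    ∃ c : HNNExtension G A B ψ, ∃ b ∈ ({1, t⁻¹} : Set (HNNExtension G A B ψ)),
      (∀ k ∈ branchCoset A B e, c⁻¹ * (of k * b) ∈ B.map of) ∧
      ∀ x, c⁻¹ * x ∈ B.map of → x * b⁻¹ ∈ (of : G →* HNNExtension G A B ψ).range := by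
  obtain ⟨u, r⟩ := e
  rcases Int.units_eq_one_or u with rfl | rfl
  -- Here the edge group is `A`, and `r⁻¹ A t⁻¹ = r⁻¹ t⁻¹ B` because `t A t⁻¹ = B`. Thus
  -- quasiconvexity of `B` alone serves both edge directions.
  · refine ⟨of r⁻¹ * t⁻¹, t⁻¹, by simp, fun k hk => ?_, ?_⟩
    · have hk' : (r * k) ∈ A := by
        simpa using A.inv_mem hk
      refine ⟨ψ ⟨r * k, hk'⟩, (ψ _).2, ?_⟩
      rw [equiv_eq_conj]
      simp [mul_assoc]
    · rintro x ⟨b, hb, hbx⟩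
      refine ⟨r⁻¹ * ψ.symm ⟨b, hb⟩, ?_⟩
      have hx : x = of r⁻¹ * t⁻¹ * of b := by rw [hbx]; group
      rw [map_mul, show (of (ψ.symm ⟨b, hb⟩ : G) : HNNExtension G A B ψ) = _ from
        equiv_symm_eq_conj ⟨b, hb⟩, hx]
      group
  · refine ⟨of r⁻¹, 1, by simp, fun k hk => ?_, ?_⟩
    · refine ⟨r * k, by simpa using B.inv_mem hk, by simp⟩
    · rintro x ⟨b, hb, hbx⟩
      refine ⟨r⁻¹ * b, ?_⟩
      rw [map_mul, hbx]
      simp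

/-- A path in a Cayley graph of an HNN-extension can enter or leave a branch at the base vertex
only near a left coset of the associated subgroup, and this coset is near the base group. -/
theorem exists_branch_separation {S : Set (HNNExtension G A B ψ)} (hS : S.Finite) :
    ∃ (F : Set (HNNExtension G A B ψ)) (c : ℤˣ × G → HNNExtension G A B ψ), F.Finite ∧
      (∀ e z z', (SimpleGraph.mulCayley S).Adj z z' →
        ¬(branch d z = some e ↔ branch d z' = some e) →
        (∃ b ∈ F, (c e)⁻¹ * (z * b) ∈ B.map of) ∨ ∃ b ∈ F, (c e)⁻¹ * (z' * b) ∈ B.map of) ∧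
      ∀ e x, (c e)⁻¹ * x ∈ B.map of →
        ∃ b ∈ F, x * b ∈ (of : G →* HNNExtension G A B ψ).range := by
  choose F hF hF' using exists_finite_mul_mem_branchCoset (ψ := ψ) d
  choose c b hb hc hc' using exists_branchCoset_eq (A := A) (B := B) (ψ := ψ)
  have hfin : (⋃ s ∈ S, F s).Finite := hS.biUnion fun s _ => hF s
  -- The products `x * b e` lead from a crossing to the coset; `1` and `t`, the possible values of
  -- `(b e)⁻¹`, lead from the coset to the base group.
  refine ⟨{t} ∪ {1} ∪ ((· * 1) '' (⋃ s ∈ S, F s) ∪ (· * t⁻¹) '' (⋃ s ∈ S, F s)), c,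
    (Set.toFinite _).union
      ((hfin.image _).union (hfin.image _)), ?_, ?_⟩
  · have key : ∀ e z s, s ∈ S → ¬(branch d z = some e ↔ branch d (z * s) = some e) →
        ∃ b ∈ {t} ∪ {1} ∪ ((· * 1) '' (⋃ s ∈ S, F s) ∪ (· * t⁻¹) '' (⋃ s ∈ S, F s)),
          (c e)⁻¹ * (z * b) ∈ B.map of := by
      intro e z s hs hne
      obtain ⟨x, hx, k, hk, hxk⟩ := hF' s z e hne
      have hx' : x ∈ ⋃ s ∈ S, F s := Set.mem_biUnion hs hx
      refine ⟨x * b e, Or.inr ?_, by rw [← mul_assoc z, hxk]; exact hc e k hk⟩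
      rcases hb e with h | h
      · exact Or.inl ⟨x, hx', by rw [h]⟩
      · exact Or.inr ⟨x, hx', by rw [h]⟩
    intro e z z' hadj hne
    rw [SimpleGraph.mulCayley_adj'] at hadj
    obtain ⟨-, s, hs, rfl | rfl⟩ := hadj
    · exact Or.inl (key e z s hs hne)
    · exact Or.inr (key e z' s hs (by rwa [iff_comm] at hne))
  · intro e x hx
    refine ⟨(b e)⁻¹, Or.inl ?_, hc' e x hx⟩
    rcases hb e with h | h <;> rw [h] <;> simp

end HNNExtension

/-! ### Four-point inequality and thin triangles -/

namespace CoarseGeometry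

variable {X Y : Type*} [PseudoMetricSpace X] [PseudoMetricSpace Y]

/-- The Gromov product in a pseudometric space. -/
noncomputable def product (x y o : X) : ℝ := (dist x o + dist y o - dist x y) / 2

/-- The four-point inequality with constant `δ`. -/
def FourPoint (X : Type*) [PseudoMetricSpace X] (δ : ℝ) : Prop :=
  ∀ x y z o : X, min (product x z o) (product y z o) - δ ≤ product x y o

/-- `γ 0, …, γ n` is a discrete geodesic from `x` to `y`. -/
structure IsGeodesic (n : ℕ) (γ : ℕ → X) (x y : X) : Prop where
  source : γ 0 = x
  target : γ n = y
  dist_eq : ∀ i j, i ≤ j → j ≤ n → dist (γ i) (γ j) = (j : ℝ) - i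

/-- Any two points are joined by a discrete geodesic. -/
def HasGeodesics (X : Type*) [PseudoMetricSpace X] : Prop :=
  ∀ x y : X, ∃ n γ, IsGeodesic n γ x y

/-- Geodesic triangles are `η`-thin. -/
def ThinTriangles (X : Type*) [PseudoMetricSpace X] (η : ℝ) : Prop :=
  ∀ (x y z : X) (n n₁ n₂ : ℕ) (γ γ₁ γ₂ : ℕ → X), IsGeodesic n γ x y → IsGeodesic n₁ γ₁ x z →
    IsGeodesic n₂ γ₂ z y → ∀ i ≤ n,
      (∃ j ≤ n₁, dist (γ i) (γ₁ j) ≤ η) ∨ ∃ j ≤ n₂, dist (γ i) (γ₂ j) ≤ η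

namespace IsGeodesic

variable {n : ℕ} {γ : ℕ → X} {x y : X}

theorem dist_source (h : IsGeodesic n γ x y) {i : ℕ} (hi : i ≤ n) : dist x (γ i) = i := by
  rw [← h.source, h.dist_eq 0 i (Nat.zero_le i) hi]; simp

theorem dist_target (h : IsGeodesic n γ x y) {i : ℕ} (hi : i ≤ n) :
    dist (γ i) y = (n : ℝ) - i := by
  rw [← h.target, h.dist_eq i n hi le_rfl]

theorem dist_endpoints (h : IsGeodesic n γ x y) : dist x y = n := by
  rw [← h.target, h.dist_source le_rfl]

theorem dist_succ (h : IsGeodesic n γ x y) {i : ℕ} (hi : i < n) :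
    dist (γ i) (γ (i + 1)) = 1 := by
  rw [h.dist_eq i (i + 1) (Nat.le_succ i) hi]; push_cast; ring

/-- In a hyperbolic space the Gromov product bounds the distance to a geodesic from above. -/
theorem exists_dist_le (h : IsGeodesic n γ x y) {δ : ℝ} (hX : FourPoint X δ) (z : X) :
    ∃ i ≤ n, dist z (γ i) ≤ product x y z + 2 * δ + 2 := by
  set s : ℝ := product z y x with hs
  have hxy := h.dist_endpoints
  have h1 := dist_triangle z x y
  have h2 := dist_triangle x z y
  have h3 := dist_triangle x y z
  rw [dist_comm z x] at h1
  rw [dist_comm y z] at h3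
  have hs' : s = (dist x z + n - dist z y) / 2 := by
    rw [hs, product, dist_comm z x, dist_comm y x, hxy]
  have hs0 : 0 ≤ s := by rw [hs']; linarith
  have hsn : s ≤ n := by rw [hs']; linarith
  have hf := Nat.floor_le hs0
  have hf' := (Nat.lt_floor_add_one s).le
  have hin : ⌊s⌋₊ ≤ n := by exact_mod_cast hf.trans hsn
  refine ⟨⌊s⌋₊, hin, ?_⟩
  -- This is the branch point of the comparison tripod, up to rounding: `product x z w` and `product
  -- y z w` both nearly equal `(dist z w - product x y z) / 2`, while `product x y w = 0`.
  set w := γ ⌊s⌋₊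
  have hxw : dist x w = ⌊s⌋₊ := h.dist_source hin
  have hwy : dist w y = n - ⌊s⌋₊ := h.dist_target hin
  have h4 := hX x y z w
  simp only [product] at h4 ⊢
  rw [hxy, hxw, dist_comm y w, hwy, dist_comm y z] at h4
  rw [hxy, dist_comm y z]
  rcases min_le_iff.1 (le_refl (min ((↑⌊s⌋₊ + dist z w - dist x z) / 2)
    ((n - ↑⌊s⌋₊ + dist z w - dist z y) / 2))) with h5 | h5 <;> linarith

end IsGeodesic

variable {δ : ℝ}

theorem product_comm (x y o : X) : product x y o = product y x o := by
  rw [product, product, dist_comm x y]; ring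

/-- A point of a geodesic between two points is uniformly close to any geodesic between nearby
points. -/
theorem FourPoint.exists_dist_le_of_near (hX : FourPoint X δ) {n m : ℕ} {γ γ' : ℕ → X}
    {x y x' y' : X} (h : IsGeodesic n γ x y) (h' : IsGeodesic m γ' x' y') {C : ℝ}
    (hx : dist x x' ≤ C) (hy : dist y y' ≤ C) {i : ℕ} (hi : i ≤ n) :
    ∃ j ≤ m, dist (γ i) (γ' j) ≤ 2 * C + 2 * δ + 2 := by
  obtain ⟨j, hj, hd⟩ := h'.exists_dist_le hX (γ i)
  refine ⟨j, hj, hd.trans ?_⟩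
  have h1 := dist_triangle x' x (γ i)
  have h2 := dist_triangle y' y (γ i)
  have h3 := dist_triangle x x' y
  have h4 := dist_triangle x' y' y
  have h5 := h.dist_source hi
  have h6 := h.dist_target hi
  have h7 := h.dist_endpoints
  rw [dist_comm x' x] at h1
  rw [dist_comm y' y, dist_comm y (γ i)] at h2
  rw [dist_comm y' y] at h4
  rw [product]
  linarith

/-- At a point of the side from `x` to `y` the product of `x` and `y` vanishes, so the product of
`z` with one of them is at most `δ`, and the corresponding side passes nearby. -/
theorem FourPoint.thinTriangles (hX : FourPoint X δ) :
    ThinTriangles X (3 * δ + 2) := by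
  intro x y z n n₁ n₂ γ γ₁ γ₂ h h₁ h₂ i hi
  have h0 : product x y (γ i) = 0 := by
    rw [product, h.dist_source hi, dist_comm y, h.dist_target hi, h.dist_endpoints]; ring
  have h4 := hX x y z (γ i)
  rw [h0] at h4
  rcases min_choice (product x z (γ i)) (product y z (γ i)) with hm | hm
  · left
    obtain ⟨j, hj, hd⟩ := h₁.exists_dist_le hX (γ i)
    exact ⟨j, hj, by rw [hm] at h4; linarith⟩
  · right
    obtain ⟨j, hj, hd⟩ := h₂.exists_dist_le hX (γ i)
    exact ⟨j, hj, by rw [hm, product_comm] at h4; linarith⟩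

/-- A discrete intermediate value argument. -/
theorem exists_adjacent {P Q : ℕ → Prop} {n : ℕ} (hPQ : ∀ i ≤ n, P i ∨ Q i) (h0 : P 0)
    (hn : Q n) : ∃ i ≤ n, Q i ∧ (P i ∨ ∃ k, i = k + 1 ∧ P k) := by
  classical
  have hex : ∃ i, Q i := ⟨n, hn⟩
  refine ⟨Nat.find hex, Nat.find_min' hex hn, Nat.find_spec hex, ?_⟩
  rcases hk : Nat.find hex with _ | k
  · exact Or.inl h0
  · right
    refine ⟨k, rfl, (hPQ k ?_).resolve_right (Nat.find_min hex (by omega))⟩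
    have := Nat.find_min' hex hn
    omega

/-- By connectedness of the side from `x` to `y`, some point of it is close to both other sides of
the triangle with apex `o`; there the triangle inequalities are almost equalities. -/
theorem ThinTriangles.exists_dist_le {η : ℝ} (hX : ThinTriangles X η) (hη : 0 ≤ η)
    (hgeo : HasGeodesics X) {n : ℕ} {γ : ℕ → X} {x y : X} (h : IsGeodesic n γ x y) (o : X) :
    ∃ i ≤ n, dist o (γ i) ≤ product x y o + 2 * η + 2 := by
  obtain ⟨n₁, γ₁, h₁⟩ := hgeo x o
  obtain ⟨n₂, γ₂, h₂⟩ := hgeo o y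
  obtain ⟨i, hi, ⟨q, hq, hiq⟩, hP⟩ := exists_adjacent (n := n)
    (hX x y o n n₁ n₂ γ γ₁ γ₂ h h₁ h₂)
    ⟨0, Nat.zero_le _, by rw [h.source, h₁.source, dist_self]; exact hη⟩
    ⟨n₂, le_rfl, by rw [h.target, h₂.target, dist_self]; exact hη⟩
  have hp : ∃ p ≤ n₁, dist (γ i) (γ₁ p) ≤ η + 1 := by
    rcases hP with ⟨p, hp, hd⟩ | ⟨k, rfl, p, hp, hd⟩
    · exact ⟨p, hp, by linarith⟩
    · refine ⟨p, hp, ?_⟩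
      have h1 := h.dist_succ (i := k) hi
      have h2 := dist_triangle (γ (k + 1)) (γ k) (γ₁ p)
      rw [dist_comm (γ (k + 1)) (γ k)] at h2
      linarith
  obtain ⟨p, hp, hip⟩ := hp
  refine ⟨i, hi, ?_⟩
  have e1 := h₁.dist_source hp
  have e2 := h₁.dist_target hp
  have e3 := h₁.dist_endpoints
  have f1 := h₂.dist_source hq
  have f2 := h₂.dist_target hq
  have f3 := h₂.dist_endpoints
  have g1 := h.dist_source hi
  have g2 := h.dist_target hi
  have g3 := h.dist_endpoints
  have t1 := dist_triangle o (γ₁ p) (γ i)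
  have t2 := dist_triangle x (γ₁ p) (γ i)
  have t3 := dist_triangle o (γ₂ q) (γ i)
  have t4 := dist_triangle (γ i) (γ₂ q) y
  rw [dist_comm o (γ₁ p), dist_comm (γ₁ p) (γ i)] at t1
  rw [dist_comm (γ₁ p) (γ i)] at t2
  rw [dist_comm (γ₂ q) (γ i)] at t3
  rw [product, dist_comm y o]
  linarith

/-- The Gromov product at `o` is, up to a constant, the distance from `o` to a geodesic, and
thinness compares such distances. -/
theorem ThinTriangles.fourPoint {η : ℝ} (hX : ThinTriangles X η) (hη : 0 ≤ η)
    (hgeo : HasGeodesics X) : FourPoint X (3 * η + 2) := by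
  intro x y z o
  obtain ⟨n, γ, h⟩ := hgeo x y
  obtain ⟨n₁, γ₁, h₁⟩ := hgeo x z
  obtain ⟨n₂, γ₂, h₂⟩ := hgeo z y
  obtain ⟨i, hi, hd⟩ := hX.exists_dist_le hη hgeo h o
  have key : ∀ {m : ℕ} {c : ℕ → X} {a b : X}, IsGeodesic m c a b → ∀ j ≤ m,
      product a b o ≤ dist o (c j) := by
    intro m c a b hc j hj
    have h1 := dist_triangle a (c j) o
    have h2 := dist_triangle b (c j) o
    have h3 := hc.dist_source hj
    have h4 := hc.dist_target hj
    have h5 := hc.dist_endpoints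
    rw [dist_comm (c j) o] at h1 h2
    rw [dist_comm b (c j)] at h2
    rw [product]
    linarith
  rcases hX x y z n n₁ n₂ γ γ₁ γ₂ h h₁ h₂ i hi with ⟨j, hj, hij⟩ | ⟨j, hj, hij⟩
  · have h1 := key h₁ j hj
    have h2 := dist_triangle o (γ i) (γ₁ j)
    have h3 := min_le_left (product x z o) (product y z o)
    linarith
  · have h1 := key h₂ j hj
    have h2 := dist_triangle o (γ i) (γ₂ j)
    have h3 := min_le_right (product x z o) (product y z o)
    rw [product_comm y z] at h3 ⊢
    linarith

/-! ### The Morse lemma and bi-Lipschitz invariance -/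

/-- Along a chain of points, the Gromov product decays at most logarithmically. -/
theorem FourPoint.le_product_of_chain (hX : FourPoint X δ) (o : X) (u : ℕ → X)
    {r L : ℝ} (hL : 0 ≤ L) (k : ℕ) : ∀ a b : ℕ, a ≤ b → b - a ≤ 2 ^ k →
    (∀ i, a ≤ i → i ≤ b → r ≤ dist o (u i)) →
    (∀ i, a ≤ i → i < b → dist (u i) (u (i + 1)) ≤ L) →
    r - L / 2 - k * δ ≤ product (u a) (u b) o := by
  induction k with
  | zero =>
    intro a b hab hba hr hs
    have h1 := hr a le_rfl hab
    have h2 := hr b hab le_rfl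
    have h3 : dist (u a) (u b) ≤ L := by
      rcases hab.eq_or_lt with rfl | hlt
      · simpa using hL
      · obtain rfl : b = a + 1 := by simp at hba; omega
        exact hs a le_rfl hlt
    rw [product, dist_comm (u a) o, dist_comm (u b) o]
    simp only [Nat.cast_zero, zero_mul]
    linarith
  | succ k ih =>
    intro a b hab hba hr hs
    rw [pow_succ] at hba
    -- Each bisection of the chain costs one `δ`.
    have h1 := ih a ((a + b) / 2) (by omega) (by omega) (fun i hi hi' => hr i hi (by omega))
      (fun i hi hi' => hs i hi (by omega))
    have h2 := ih ((a + b) / 2) b (by omega) (by omega) (fun i hi hi' => hr i (by omega) hi')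
      (fun i hi hi' => hs i (by omega) hi')
    have h3 := hX (u a) (u b) (u ((a + b) / 2)) o
    rw [product_comm (u b)] at h3
    have h4 := le_min h1 h2
    push_cast
    linarith

/-- Exponential growth beats affine growth. -/
theorem exists_forall_le_two_pow (a b : ℝ) : ∃ k₀ : ℕ, ∀ k : ℕ, k₀ ≤ k → a + b * k ≤ 2 ^ k := by
  have h1 : Filter.Tendsto (fun k : ℕ => (k : ℝ) ^ 1 / 2 ^ k) Filter.atTop (nhds 0) :=
    tendsto_pow_const_div_const_pow_of_one_lt 1 (by norm_num)
  have h0 : Filter.Tendsto (fun k : ℕ => (k : ℝ) ^ 0 / 2 ^ k) Filter.atTop (nhds 0) :=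
    tendsto_pow_const_div_const_pow_of_one_lt 0 (by norm_num)
  have h2 := (h0.const_mul a).add (h1.const_mul b)
  simp only [mul_zero, add_zero] at h2
  obtain ⟨k₀, hk⟩ := Filter.eventually_atTop.1 (h2.eventually (gt_mem_nhds (zero_lt_one' ℝ)))
  refine ⟨k₀, fun k hkk => ?_⟩
  have h3 := hk k hkk
  rw [← mul_div_assoc, ← mul_div_assoc, ← add_div, div_lt_one (by positivity)] at h3
  simpa using h3.le

/-- A quantity that is at most affine in its own logarithm is bounded. -/
theorem exists_bound_of_log_bound (δ A a b : ℝ) (hδ : 0 ≤ δ) (ha : 0 ≤ a) : ∃ D : ℝ, ∀ M : ℝ,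
    (∀ k : ℕ, a * M + b ≤ 2 ^ k → M ≤ A + k * δ) → M ≤ D := by
  obtain ⟨k₀, hk₀⟩ := exists_forall_le_two_pow (a * (A + δ) + b) (a * δ)
  refine ⟨A + k₀ * δ, fun M hM => ?_⟩
  classical
  have hex : ∃ k : ℕ, a * M + b ≤ 2 ^ k := by
    obtain ⟨k, hk⟩ := exists_forall_le_two_pow (a * M + b) 0
    exact ⟨k, by simpa using hk k le_rfl⟩
  by_cases h : Nat.find hex ≤ k₀
  · have h1 := hM _ (Nat.find_spec hex)
    have h2 : ((Nat.find hex : ℕ) : ℝ) ≤ k₀ := by exact_mod_cast h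
    have := mul_le_mul_of_nonneg_right h2 hδ
    linarith
  · obtain ⟨k, hk⟩ : ∃ k, Nat.find hex = k + 1 := ⟨Nat.find hex - 1, by omega⟩
    have h1 := hM _ (Nat.find_spec hex)
    have h2 := hk₀ k (by omega)
    -- By minimality `2 ^ k < a * M + b`, but `M` is affine in `k` and `k ≥ k₀`.
    refine absurd (le_trans ?_ h2) (Nat.find_min hex (m := k) (by omega))
    rw [hk] at h1
    push_cast at h1
    have := mul_le_mul_of_nonneg_left h1 ha
    linarith

/-- `c 0, …, c n` is a discrete bi-Lipschitz path with constant `L`. -/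
structure IsBiLipschitzPath (L : ℝ) (n : ℕ) (c : ℕ → Y) : Prop where
  le : ∀ i j, i ≤ j → j ≤ n → dist (c i) (c j) ≤ L * ((j : ℝ) - i)
  ge : ∀ i j, i ≤ j → j ≤ n → (j : ℝ) - i ≤ L * dist (c i) (c j)

/-- The lower Lipschitz bound limits the number of steps between `c a` and `c b`, so the loss is
logarithmic in their distance. -/
theorem FourPoint.le_product_of_biLipschitz (hY : FourPoint Y δ) {L : ℝ}
    (hL : 0 ≤ L) {n : ℕ} {c : ℕ → Y} (hc : IsBiLipschitzPath L n c) (o : Y) {r : ℝ}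
    (hr : ∀ i ≤ n, r ≤ dist o (c i)) {a b : ℕ} (ha : a ≤ n) (hb : b ≤ n) (k : ℕ)
    (hk : L * dist (c a) (c b) ≤ 2 ^ k) :
    r - L / 2 - k * δ ≤ product (c a) (c b) o := by
  wlog hab : a ≤ b generalizing a b
  · rw [product_comm]
    exact this hb ha (by rwa [dist_comm]) (by omega)
  refine hY.le_product_of_chain o c hL k a b hab ?_ (fun i _ hi => hr i (by omega)) ?_
  · have h1 := (hc.ge a b hab hb).trans hk
    have h2 : ((b - a : ℕ) : ℝ) ≤ ((2 ^ k : ℕ) : ℝ) := by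
      rw [Nat.cast_sub hab]; push_cast; exact h1
    exact_mod_cast h2
  · intro i _ hi
    have h1 := hc.le i (i + 1) (by omega) (by omega)
    push_cast at h1
    linarith

/-- A geodesic lies uniformly close to a bi-Lipschitz path with the same endpoints. -/
theorem FourPoint.exists_geodesic_near_biLipschitz (hδ : 0 ≤ δ) (hY : FourPoint Y δ) {L : ℝ}
    (hL : 0 ≤ L) : ∃ D : ℝ, 0 ≤ D ∧ ∀ (n m : ℕ) (c γ : ℕ → Y), IsBiLipschitzPath L n c →
      IsGeodesic m γ (c 0) (c n) → ∀ j ≤ m, ∃ i ≤ n, dist (γ j) (c i) ≤ D := by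
  obtain ⟨D, hD⟩ := exists_bound_of_log_bound δ (L / 2 + 2 * δ) (L * 6) (L * 2) hδ (by positivity)
  refine ⟨max D 0, le_max_right _ _, fun n m c γ hc hγ => ?_⟩
  have hmin : ∀ j, ∃ i ≤ n, ∀ i' ≤ n, dist (γ j) (c i) ≤ dist (γ j) (c i') := by
    intro j
    obtain ⟨i, hi, hi'⟩ := Finset.exists_min_image (Finset.range (n + 1))
      (fun i => dist (γ j) (c i)) ⟨0, by simp⟩
    exact ⟨i, by simpa [Nat.lt_succ_iff] using hi, fun i' h => hi' i' (by simp; omega)⟩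
  choose I hIn hI using hmin
  -- Take the point of `γ` farthest from `c`, at distance `M`. Go about `2 * M` along `γ` to each
  -- side (or to the end), then to nearest points of `c`. The arc of `c` between these avoids the
  -- `M`-ball around `γ j₀`, so `M` is at most logarithmic in `M`.
  obtain ⟨j₀, hj₀, hmax⟩ := Finset.exists_max_image (Finset.range (m + 1))
    (fun j => dist (γ j) (c (I j))) ⟨0, by simp⟩
  replace hj₀ : j₀ ≤ m := by simpa [Nat.lt_succ_iff] using hj₀
  replace hmax : ∀ j ≤ m, dist (γ j) (c (I j)) ≤ dist (γ j₀) (c (I j₀)) :=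
    fun j hj => hmax j (by simp; omega)
  set M := dist (γ j₀) (c (I j₀)) with hM
  have hM0 : 0 ≤ M := dist_nonneg
  have hend0 : dist (γ 0) (c (I 0)) ≤ 0 := by
    simpa [hγ.source] using hI 0 0 (Nat.zero_le _)
  have hendm : dist (γ m) (c (I m)) ≤ 0 := by
    simpa [hγ.target] using hI m n le_rfl
  suffices h : M ≤ D from fun j hj =>
    ⟨I j, hIn j, (hmax j hj).trans (h.trans (le_max_left _ _))⟩
  have hceil := Nat.le_ceil (2 * M)
  have hceil' := (Nat.ceil_lt_add_one (by linarith : 0 ≤ 2 * M)).le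
  set N := ⌈2 * M⌉₊
  have hfar : ∀ j ≤ m, (2 * M ≤ dist (γ j) (γ j₀) ∨ dist (γ j) (c (I j)) ≤ 0) →
      M ≤ product (γ j) (c (I j)) (γ j₀) := by
    intro j hj h
    have h1 := hI j₀ (I j) (hIn j)
    have h2 := hmax j hj
    rw [product, dist_comm (c (I j))]
    rcases h with h | h
    · linarith
    · have h3 := dist_triangle (γ j₀) (γ j) (c (I j))
      rw [dist_comm (γ j₀) (γ j)] at h3
      linarith
  obtain ⟨j₁, hj₁, hj₁', h₁⟩ : ∃ j₁ ≤ j₀, j₀ ≤ j₁ + N ∧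
      (2 * M ≤ dist (γ j₁) (γ j₀) ∨ dist (γ j₁) (c (I j₁)) ≤ 0) := by
    by_cases h : N ≤ j₀
    · refine ⟨j₀ - N, by omega, by omega, Or.inl ?_⟩
      rw [hγ.dist_eq _ _ (by omega) hj₀, Nat.cast_sub h]
      linarith
    · exact ⟨0, by omega, by omega, Or.inr hend0⟩
  obtain ⟨j₂, hj₂, hj₂m, hj₂', h₂⟩ : ∃ j₂, j₀ ≤ j₂ ∧ j₂ ≤ m ∧ j₂ ≤ j₀ + N ∧
      (2 * M ≤ dist (γ j₂) (γ j₀) ∨ dist (γ j₂) (c (I j₂)) ≤ 0) := by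
    by_cases h : j₀ + N ≤ m
    · refine ⟨j₀ + N, by omega, h, le_rfl, Or.inl ?_⟩
      rw [dist_comm, hγ.dist_eq _ _ (by omega) h]
      push_cast
      linarith
    · exact ⟨m, by omega, le_rfl, by omega, Or.inr hendm⟩
  refine hD M fun k hk => ?_
  have p₁ := hfar j₁ (by omega) h₁
  have p₂ := hfar j₂ hj₂m h₂
  have hdist : dist (γ j₁) (γ j₂) ≤ 4 * M + 2 := by
    rw [hγ.dist_eq _ _ (by omega) hj₂m]
    have e1 : (j₀ : ℝ) ≤ j₁ + N := by exact_mod_cast hj₁'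
    have e2 : (j₂ : ℝ) ≤ j₀ + N := by exact_mod_cast hj₂'
    linarith
  have hdist' : dist (c (I j₁)) (c (I j₂)) ≤ 6 * M + 2 := by
    have e1 := dist_triangle4 (c (I j₁)) (γ j₁) (γ j₂) (c (I j₂))
    have e2 := hmax j₁ (by omega)
    have e3 := hmax j₂ hj₂m
    rw [dist_comm (c (I j₁)) (γ j₁)] at e1
    linarith
  have p₃ := hY.le_product_of_biLipschitz hL hc (γ j₀) (r := M) (hI j₀)
    (hIn j₁) (hIn j₂) k (by
      have := mul_le_mul_of_nonneg_left hdist' hL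
      linarith)
  -- The detour forces this vanishing product to be at least `M - L / 2 - k * δ - 2 * δ`.
  have p₀ : product (γ j₁) (γ j₂) (γ j₀) = 0 := by
    rw [product, dist_comm (γ j₂), hγ.dist_eq _ _ hj₁ hj₀, hγ.dist_eq _ _ hj₂ hj₂m,
      hγ.dist_eq _ _ (hj₁.trans hj₂) hj₂m]
    ring
  have q₁ := hY (γ j₁) (c (I j₂)) (c (I j₁)) (γ j₀)
  have q₂ := hY (γ j₁) (γ j₂) (c (I j₂)) (γ j₀)
  rw [product_comm (c (I j₂))] at q₁
  have hk0 : 0 ≤ k * δ := by positivity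
  have r₁ : M - L / 2 - k * δ ≤ min (product (γ j₁) (c (I j₁)) (γ j₀))
      (product (c (I j₁)) (c (I j₂)) (γ j₀)) := le_min (by linarith) p₃
  have r₂ : M - L / 2 - k * δ - δ ≤ min (product (γ j₁) (c (I j₂)) (γ j₀))
      (product (γ j₂) (c (I j₂)) (γ j₀)) := le_min (by linarith) (by linarith)
  linarith

/-- A bi-Lipschitz path lies uniformly close to a geodesic with the same endpoints. -/
theorem FourPoint.exists_biLipschitz_near_geodesic (hδ : 0 ≤ δ) (hY : FourPoint Y δ) {L : ℝ}
    (hL : 0 ≤ L) : ∃ D : ℝ, 0 ≤ D ∧ ∀ (n m : ℕ) (c γ : ℕ → Y), IsBiLipschitzPath L n c →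
      IsGeodesic m γ (c 0) (c n) → ∀ i ≤ n, ∃ j ≤ m, dist (c i) (γ j) ≤ D := by
  obtain ⟨D, hD0, hD⟩ := hY.exists_geodesic_near_biLipschitz hδ hL
  refine ⟨L * (L * (2 * D + 1)) + D, by positivity, fun n m c γ hc hγ i hi => ?_⟩
  have h2D : D ≤ 2 * D + 1 := by linarith
  -- Some point of `γ` is close to points of `c` both before and after `c i`; the parameters of
  -- these points differ boundedly, so `c i` is close too.
  obtain ⟨j, hj, ⟨p, hip, hp, hjp⟩, h⟩ := exists_adjacent (n := m)
    (P := fun j => ∃ p ≤ i, p ≤ n ∧ dist (γ j) (c p) ≤ D)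
    (Q := fun j => ∃ p, i ≤ p ∧ p ≤ n ∧ dist (γ j) (c p) ≤ D)
    (fun j hj => by
      obtain ⟨p, hp, hd⟩ := hD n m c γ hc hγ j hj
      rcases le_total p i with h | h
      · exact Or.inl ⟨p, h, hp, hd⟩
      · exact Or.inr ⟨p, h, hp, hd⟩)
    ⟨0, Nat.zero_le _, Nat.zero_le _, by rw [hγ.source, dist_self]; exact hD0⟩
    ⟨n, hi, le_rfl, by rw [hγ.target, dist_self]; exact hD0⟩
  obtain ⟨q, hqi, hjq⟩ : ∃ q ≤ i, dist (γ j) (c q) ≤ D + 1 := by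
    rcases h with ⟨q, hqi, hq, hd⟩ | ⟨k, rfl, q, hqi, hq, hd⟩
    · exact ⟨q, hqi, by linarith⟩
    · refine ⟨q, hqi, ?_⟩
      have h1 := hγ.dist_succ (i := k) hj
      have h2 := dist_triangle (γ (k + 1)) (γ k) (c q)
      rw [dist_comm (γ (k + 1)) (γ k)] at h2
      linarith
  refine ⟨j, hj, ?_⟩
  have h1 := dist_triangle_left (c q) (c p) (γ j)
  have h2 := hc.ge q p (hqi.trans hip) hp
  have h3 := hc.le i p hip hp
  have h4 : (p : ℝ) - i ≤ L * (2 * D + 1) := by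
    have e1 : (q : ℝ) ≤ i := by exact_mod_cast hqi
    have e2 : dist (c q) (c p) ≤ 2 * D + 1 := by linarith
    have := mul_le_mul_of_nonneg_left e2 hL
    linarith
  have h5 := mul_le_mul_of_nonneg_left h4 hL
  have h6 := dist_triangle (c i) (c p) (γ j)
  rw [dist_comm (c p) (γ j)] at h6
  linarith

/-- Hyperbolicity of geodesic spaces passes to bi-Lipschitz embedded spaces. -/
theorem FourPoint.of_biLipschitz (hδ : 0 ≤ δ) (hY : FourPoint Y δ) (hX : HasGeodesics X)
    (hY' : HasGeodesics Y) (f : X → Y) {L : ℝ} (hL : 0 ≤ L)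
    (hf : ∀ x y, dist (f x) (f y) ≤ L * dist x y) (hf' : ∀ x y, dist x y ≤ L * dist (f x) (f y)) :
    ∃ δ' : ℝ, 0 ≤ δ' ∧ FourPoint X δ' := by
  obtain ⟨D, hD0, hD⟩ := hY.exists_geodesic_near_biLipschitz hδ hL
  obtain ⟨E, hE0, hE⟩ := hY.exists_biLipschitz_near_geodesic hδ hL
  have hpath : ∀ {n : ℕ} {γ : ℕ → X} {x y : X}, IsGeodesic n γ x y →
      IsBiLipschitzPath L n (f ∘ γ) := fun h =>
    ⟨fun i j hij hj => by rw [← h.dist_eq i j hij hj]; exact hf _ _,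
      fun i j hij hj => by rw [← h.dist_eq i j hij hj]; exact hf' _ _⟩
  have hη : 0 ≤ L * (E + (3 * δ + 2) + D) := by positivity
  refine ⟨3 * (L * (E + (3 * δ + 2) + D)) + 2, by positivity,
    ThinTriangles.fourPoint ?_ hη hX⟩
  intro x y z n n₁ n₂ γ γ₁ γ₂ h h₁ h₂ i hi
  obtain ⟨m, α, hα⟩ := hY' (f x) (f y)
  obtain ⟨m₁, α₁, hα₁⟩ := hY' (f x) (f z)
  obtain ⟨m₂, α₂, hα₂⟩ := hY' (f z) (f y)
  obtain ⟨j, hj, hij⟩ := hE n m (f ∘ γ) α (hpath h)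
    (by simpa [h.source, h.target] using hα) i hi
  have key : ∀ {n' m' : ℕ} {γ' : ℕ → X} {α' : ℕ → Y} {a b : X}, IsGeodesic n' γ' a b →
      IsGeodesic m' α' (f a) (f b) → (∃ l ≤ m', dist (α j) (α' l) ≤ 3 * δ + 2) →
      ∃ q ≤ n', dist (γ i) (γ' q) ≤ L * (E + (3 * δ + 2) + D) := by
    rintro n' m' γ' α' a b h' hα' ⟨l, hl, hjl⟩
    obtain ⟨q, hq, hlq⟩ := hD n' m' (f ∘ γ') α' (hpath h')
      (by simpa [h'.source, h'.target] using hα') l hl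
    refine ⟨q, hq, (hf' _ _).trans (mul_le_mul_of_nonneg_left ?_ hL)⟩
    refine (dist_triangle4 _ (α j) (α' l) _).trans ?_
    simp only [Function.comp_apply] at hij hlq
    linarith
  rcases hY.thinTriangles (f x) (f y) (f z) m m₁ m₂ α α₁ α₂ hα hα₁ hα₂ j hj with hl | hl
  · exact Or.inl (key h₁ hα₁ hl)
  · exact Or.inr (key h₂ hα₂ hl)

end CoarseGeometry

open CoarseGeometry

/-! ### Path metrics of graphs -/

namespace SimpleGraph

variable {V W : Type*} {Γ : SimpleGraph V} {Γ' : SimpleGraph W}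

/-- The path metric of a connected graph. -/
@[reducible] noncomputable def Connected.pathMetric (hΓ : Γ.Connected) : PseudoMetricSpace V where
  dist x y := Γ.dist x y
  dist_self x := by simp
  dist_comm x y := by rw [SimpleGraph.dist_comm]
  dist_triangle x y z := by exact_mod_cast hΓ.dist_triangle

theorem Walk.isGeodesic (hΓ : Γ.Connected) {x y : V} (p : Γ.Walk x y)
    (hp : p.length = Γ.dist x y) :
    letI := hΓ.pathMetric
    IsGeodesic p.length p.getVert x y := by
  let := hΓ.pathMetric
  refine ⟨p.getVert_zero, p.getVert_length, fun i j hij hj => ?_⟩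
  have hle : ∀ {a b : V} (q : Γ.Walk a b) (k : ℕ), k ≤ q.length → Γ.dist a (q.getVert k) ≤ k :=
    fun q k hk => (dist_le (q.take k)).trans (by simp)
  -- The upper bounds for the three pieces add up to the distance of the endpoints, so each is an
  -- equality.
  have h1 := hle p i (hij.trans hj)
  have h2 : Γ.dist (p.getVert i) (p.getVert j) ≤ j - i := by
    have := hle (p.drop i) (j - i) (by simp; omega)
    rwa [Walk.drop_getVert, Nat.add_sub_cancel' hij] at this
  have h3 : Γ.dist (p.getVert j) y ≤ p.length - j := (dist_le (p.drop j)).trans (by simp)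
  have h4 : Γ.dist x y ≤ Γ.dist x (p.getVert i) + Γ.dist (p.getVert i) y := hΓ.dist_triangle
  have h5 : Γ.dist (p.getVert i) y ≤ Γ.dist (p.getVert i) (p.getVert j) + Γ.dist (p.getVert j) y :=
    hΓ.dist_triangle
  have h6 : Γ.dist (p.getVert i) (p.getVert j) = j - i := by omega
  change ((Γ.dist (p.getVert i) (p.getVert j) : ℕ) : ℝ) = _
  rw [h6, Nat.cast_sub hij]

theorem Connected.hasGeodesics (hΓ : Γ.Connected) :
    letI := hΓ.pathMetric
    HasGeodesics V := by
  intro x y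
  obtain ⟨p, hp⟩ := hΓ.exists_walk_length_eq_dist x y
  exact ⟨_, _, p.isGeodesic hΓ hp⟩

theorem isHyperbolicGraph_iff :
    IsHyperbolicGraph Γ ↔ ∃ hΓ : Γ.Connected, ∃ δ : ℝ, 0 ≤ δ ∧
      letI := hΓ.pathMetric
      FourPoint V δ :=
  ⟨fun ⟨h, h'⟩ => ⟨h, h'⟩, fun ⟨h, h'⟩ => ⟨h, h'⟩⟩

/-- A map that moves the ends of edges to bounded distance is Lipschitz. -/
theorem dist_le_mul_dist_of_adj (hΓ : Γ.Connected) (hΓ' : Γ'.Connected) (f : V → W) {L : ℕ}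
    (hf : ∀ x y, Γ.Adj x y → Γ'.dist (f x) (f y) ≤ L) (x y : V) :
    Γ'.dist (f x) (f y) ≤ L * Γ.dist x y := by
  obtain ⟨p, hp⟩ := hΓ.exists_walk_length_eq_dist x y
  rw [← hp]
  clear hp
  induction p with
  | nil => simp
  | cons h p ih =>
    have := hf _ _ h
    refine hΓ'.dist_triangle.trans ((add_le_add this ih).trans ?_)
    rw [Walk.length_cons, mul_add, mul_one, add_comm]

/-- Hyperbolicity passes to graphs with a bi-Lipschitz map to a hyperbolic graph. -/
theorem isHyperbolicGraph_of_biLipschitz (hΓ : Γ.Connected) (hΓ' : IsHyperbolicGraph Γ')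
    (f : V → W) {L : ℕ} (hf : ∀ x y, Γ'.dist (f x) (f y) ≤ L * Γ.dist x y)
    (hf' : ∀ x y, Γ.dist x y ≤ L * Γ'.dist (f x) (f y)) : IsHyperbolicGraph Γ := by
  obtain ⟨hc, δ, hδ, h⟩ := isHyperbolicGraph_iff.1 hΓ'
  let := hΓ.pathMetric
  let := hc.pathMetric
  refine isHyperbolicGraph_iff.2 ⟨hΓ, h.of_biLipschitz hδ hΓ.hasGeodesics hc.hasGeodesics f
    (L := L) L.cast_nonneg (fun x y => ?_) fun x y => ?_⟩
  · change ((Γ'.dist (f x) (f y) : ℕ) : ℝ) ≤ L * ((Γ.dist x y : ℕ) : ℝ)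
    exact_mod_cast hf x y
  · change ((Γ.dist x y : ℕ) : ℝ) ≤ L * ((Γ'.dist (f x) (f y) : ℕ) : ℝ)
    exact_mod_cast hf' x y

/-! ### Cayley graphs and quasiconvex subgroups -/

section Cayley

variable {G H : Type*} [Group G] [Group H] {S T : Set G}

theorem Reachable.mulCayley_mul_left {x y : G} (h : (mulCayley S).Reachable x y) (g : G) :
    (mulCayley S).Reachable (g * x) (g * y) :=
  h.map (⟨(g * ·), fun h => mulCayley_adj_mul_iff_right.2 h⟩ : mulCayley S →g mulCayley S)

theorem connected_mulCayley (hS : Subgroup.closure S = ⊤) : (mulCayley S).Connected := by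
  have key : ∀ g, (mulCayley S).Reachable 1 g := by
    intro g
    have hg : g ∈ Subgroup.closure S := hS ▸ Subgroup.mem_top g
    induction hg using Subgroup.closure_induction with
    | mem x hx =>
      by_cases h : (1 : G) = x
      · rw [h]
      · exact Adj.reachable ((mulCayley_adj' S 1 x).2 ⟨h, x, hx, Or.inl (one_mul x)⟩)
    | one => rfl
    | mul x y _ _ hx hy => exact hx.trans (by simpa using hy.mulCayley_mul_left x)
    | inv x _ hx => exact (by simpa using hx.mulCayley_mul_left x⁻¹ : (mulCayley S).Reachable x⁻¹ 1).symm
  exact (connected_iff _).2 ⟨fun x y => (key x).symm.trans (key y), ⟨1⟩⟩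

theorem dist_mulCayley_mul_left (hS : (mulCayley S).Connected) (g x y : G) :
    (mulCayley S).dist (g * x) (g * y) = (mulCayley S).dist x y := by
  have key : ∀ g x y, (mulCayley S).dist (g * x) (g * y) ≤ (mulCayley S).dist x y := by
    intro g x y
    have := dist_le_mul_dist_of_adj hS hS (g * ·) (L := 1)
      (fun x y h => (dist_eq_one_iff_adj.2 (mulCayley_adj_mul_iff_right.2 h)).le) x y
    simpa using this
  refine le_antisymm (key g x y) ?_
  simpa using key g⁻¹ (g * x) (g * y)

theorem dist_mulCayley_mul_right (hS : (mulCayley S).Connected) (x s : G) :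
    (mulCayley S).dist x (x * s) = (mulCayley S).dist 1 s := by
  simpa using dist_mulCayley_mul_left hS x 1 s

theorem dist_mulCayley_eq (hS : (mulCayley S).Connected) (x y : G) :
    (mulCayley S).dist x y = (mulCayley S).dist 1 (x⁻¹ * y) := by
  simpa using dist_mulCayley_mul_right hS x (x⁻¹ * y)

theorem exists_dist_mulCayley_le (S : Set G) {F : Set G} (hF : F.Finite) :
    ∃ C : ℕ, ∀ b ∈ F, (mulCayley S).dist 1 b ≤ C := by
  obtain ⟨C, hC⟩ := (hF.image ((mulCayley S).dist 1)).bddAbove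
  exact ⟨C, fun b hb => hC ⟨b, hb, rfl⟩⟩

theorem exists_mem_mul_eq_of_adj_mulCayley {x y : G} (h : (mulCayley S).Adj x y) :
    x⁻¹ * y ∈ S ∪ S⁻¹ := by
  obtain ⟨-, s, hs, rfl | rfl⟩ := (mulCayley_adj' S x y).1 h
  · left; simpa using hs
  · right; simpa using hs

/-- A homomorphism between finitely generated groups is Lipschitz. -/
theorem exists_dist_mulCayley_map_le (hfin : S.Finite) (hS : (mulCayley S).Connected) {T : Set H}
    (hT : (mulCayley T).Connected) (f : G →* H) : ∃ L : ℕ, ∀ x y,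
      (mulCayley T).dist (f x) (f y) ≤ L * (mulCayley S).dist x y := by
  obtain ⟨L, hL⟩ := exists_dist_mulCayley_le T ((hfin.union hfin.inv).image f)
  refine ⟨L, dist_le_mul_dist_of_adj hS hT f fun x y h => ?_⟩
  rw [dist_mulCayley_eq hT, ← map_inv, ← map_mul]
  exact hL _ ⟨_, exists_mem_mul_eq_of_adj_mulCayley h, rfl⟩

theorem finite_ball_mulCayley (hfin : S.Finite) (hS : (mulCayley S).Connected) (n : ℕ) :
    {g | (mulCayley S).dist 1 g ≤ n}.Finite := by
  induction n with
  | zero =>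
    refine (Set.finite_singleton 1).subset fun g hg => ?_
    exact (hS.dist_eq_zero_iff.1 (Nat.le_zero.1 hg)).symm
  | succ n ih =>
    refine ((ih.mul (hfin.union hfin.inv)).union ih).subset fun g hg => ?_
    obtain ⟨p, hp⟩ := hS.exists_walk_length_eq_dist g 1
    rw [dist_comm] at hp
    cases p with
    | nil => right; simp
    | cons h q =>
      rename_i v
      left
      refine ⟨v, ?_, v⁻¹ * g, exists_mem_mul_eq_of_adj_mulCayley h.symm, by simp⟩
      have h1 := dist_le q
      rw [dist_comm] at h1
      rw [Walk.length_cons] at hp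
      simp only [Set.mem_ofPred_eq] at hg ⊢
      omega

/-- Hyperbolicity of a group does not depend on the finite generating set. -/
theorem isHyperbolicGraph_mulCayley (hG : IsHyperbolicGroup G) (hfin : S.Finite)
    (hS : Subgroup.closure S = ⊤) : IsHyperbolicGraph (mulCayley S) := by
  obtain ⟨T, hTfin, -, hT⟩ := hG
  have hc := connected_mulCayley hS
  obtain ⟨L, hL⟩ := exists_dist_mulCayley_map_le hfin hc hT.1 (MonoidHom.id G)
  obtain ⟨L', hL'⟩ := exists_dist_mulCayley_map_le hTfin hT.1 hc (MonoidHom.id G)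
  exact isHyperbolicGraph_of_biLipschitz hc hT id (L := max L L')
    (fun x y => (hL x y).trans (Nat.mul_le_mul_right _ (le_max_left _ _)))
    fun x y => (hL' x y).trans (Nat.mul_le_mul_right _ (le_max_right _ _))

/-- Quasiconvex subgroups of hyperbolic groups are hyperbolic. -/
theorem isHyperbolicGroup_of_isQuasiconvexSubgroup {S : Set H} (hfin : S.Finite)
    (hS : IsHyperbolicGraph (mulCayley S)) (f : G →* H) (hf : Function.Injective f)
    (hq : IsQuasiconvexSubgroup S f.range) : IsHyperbolicGroup G := by
  obtain ⟨ε, hε⟩ := hq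
  have hc := hS.1
  set T : Set G := {g | (mulCayley S).dist 1 (f g) ≤ 2 * ε + 1} with hT
  have hTfin : T.Finite := (finite_ball_mulCayley hfin hc (2 * ε + 1)).preimage hf.injOn
  -- Connectedness is an assumption of the second claim only, since it is deduced from the first.
  have key : ∀ (n : ℕ) (g : ℕ → G), (∀ i < n, (g i)⁻¹ * g (i + 1) ∈ T) →
      (g 0)⁻¹ * g n ∈ Subgroup.closure T ∧ ((mulCayley T).Connected →
        (mulCayley T).dist (g 0) (g n) ≤ n) := by
    intro n g hg
    induction n with
    | zero => simp
    | succ n ih =>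
      obtain ⟨ih₁, ih₂⟩ := ih fun i hi => hg i (by omega)
      have hn := hg n (by omega)
      refine ⟨?_, fun hTc => ?_⟩
      · have := mul_mem ih₁ (Subgroup.subset_closure hn)
        simpa [mul_assoc] using this
      · refine hTc.dist_triangle.trans (add_le_add (ih₂ hTc) ?_)
        by_cases he : g n = g (n + 1)
        · rw [he]; simp
        · exact (dist_eq_one_iff_adj.2 ((mulCayley_adj T _ _).2 ⟨he, Or.inl hn⟩)).le
  have hchain : ∀ x y : G, ∃ g : ℕ → G, g 0 = x ∧ g ((mulCayley S).dist (f x) (f y)) = y ∧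
      ∀ i < (mulCayley S).dist (f x) (f y), (g i)⁻¹ * g (i + 1) ∈ T := by
    intro x y
    obtain ⟨p, hp⟩ := hc.exists_walk_length_eq_dist (f x) (f y)
    rw [← hp]
    -- Project the geodesic to the subgroup, keeping its ends; consecutive projections are at
    -- distance at most `ε + 1 + ε`, which explains the radius in `T`.
    have hex : ∀ i, ∃ g : G, (i = 0 → g = x) ∧ (i = p.length → g = y) ∧
        (mulCayley S).dist (p.getVert i) (f g) ≤ ε := by
      intro i
      rcases Nat.eq_zero_or_pos i with rfl | hi
      · refine ⟨x, fun _ => rfl, fun h => hf ?_, by simp⟩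
        have := p.getVert_length
        rw [← h, p.getVert_zero] at this
        exact this
      by_cases hi' : i = p.length
      · exact ⟨y, fun h => by omega, fun _ => rfl, by rw [hi']; simp⟩
      · obtain ⟨_, ⟨g, rfl⟩, hg⟩ := hε (f x) (f y) p ⟨x, rfl⟩ ⟨y, rfl⟩ hp (p.getVert i)
          (p.getVert_mem_support i)
        exact ⟨g, fun h => by omega, fun h => (hi' h).elim, hg⟩
    choose g hg0 hgn hg using hex
    refine ⟨g, hg0 0 rfl, hgn _ rfl, fun i hi => ?_⟩
    have h1 := hg i
    have h2 := hg (i + 1)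
    have h3 := dist_eq_one_iff_adj.2 (p.adj_getVert_succ hi)
    rw [hT, Set.mem_ofPred_eq, map_mul, map_inv, ← dist_mulCayley_eq hc]
    rw [dist_comm] at h1
    have h4 : (mulCayley S).dist (f (g i)) (f (g (i + 1))) ≤ _ :=
      hc.dist_triangle (v := p.getVert (i + 1))
    have h5 : (mulCayley S).dist (f (g i)) (p.getVert (i + 1)) ≤ _ :=
      hc.dist_triangle (v := p.getVert i)
    omega
  have hgen : Subgroup.closure T = ⊤ := by
    refine (Subgroup.eq_top_iff' _).2 fun x => ?_
    obtain ⟨g, h0, hn, hg⟩ := hchain 1 x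
    have := (key _ g hg).1
    rwa [h0, hn, inv_one, one_mul] at this
  have hTc := connected_mulCayley hgen
  refine ⟨T, hTfin, hgen, ?_⟩
  refine isHyperbolicGraph_of_biLipschitz hTc hS f (L := 2 * ε + 1) ?_ fun x y => ?_
  · refine dist_le_mul_dist_of_adj hTc hc f fun x y h => ?_
    rcases ((mulCayley_adj T x y).1 h).2 with h | h
    · rw [dist_mulCayley_eq hc, ← map_inv, ← map_mul]
      exact h
    · rw [dist_comm, dist_mulCayley_eq hc, ← map_inv, ← map_mul]
      exact h
  · obtain ⟨g, h0, hn, hg⟩ := hchain x y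
    have := (key _ g hg).2 hTc
    rw [h0, hn] at this
    exact this.trans (Nat.le_mul_of_pos_left _ (by omega))

end Cayley

end SimpleGraph

/-! ### Quasiconvexity of the base group -/

theorem CoarseGeometry.IsGeodesic.segment {X : Type*} [PseudoMetricSpace X] {n : ℕ} {γ : ℕ → X}
    {x y : X} (h : IsGeodesic n γ x y) {i j : ℕ} (hij : i ≤ j) (hj : j ≤ n) :
    IsGeodesic (j - i) (fun l => γ (i + l)) (γ i) (γ j) where
  source := rfl
  target := by rw [Nat.add_sub_cancel' hij]
  dist_eq a b hab hb := by
    rw [h.dist_eq _ _ (by omega) (by omega)]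
    push_cast
    ring

/-- Left cosets of a quasiconvex subgroup are uniformly quasiconvex. -/
theorem IsQuasiconvexSubgroup.exists_dist_coset_le {H : Type*} [Group H] {S : Set H}
    {U : Subgroup H} (hS : (SimpleGraph.mulCayley S).Connected) (hU : IsQuasiconvexSubgroup S U) :
    ∃ ε : ℕ, ∀ (c x y : H) (p : (SimpleGraph.mulCayley S).Walk x y), c⁻¹ * x ∈ U → c⁻¹ * y ∈ U →
      p.length = (SimpleGraph.mulCayley S).dist x y → ∀ z ∈ p.support,
        ∃ u, c⁻¹ * u ∈ U ∧ (SimpleGraph.mulCayley S).dist z u ≤ ε := by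
  obtain ⟨ε, hε⟩ := hU
  refine ⟨ε, fun c x y p hx hy hp z hz => ?_⟩
  let f : SimpleGraph.mulCayley S →g SimpleGraph.mulCayley S :=
    ⟨(c⁻¹ * ·), fun h => SimpleGraph.mulCayley_adj_mul_iff_right.2 h⟩
  obtain ⟨u, hu, hzu⟩ := hε (f x) (f y) (p.map f) hx hy
    (by rw [SimpleGraph.Walk.length_map, hp]
        exact (SimpleGraph.dist_mulCayley_mul_left hS c⁻¹ x y).symm)
    (f z) (by rw [SimpleGraph.Walk.support_map]; exact List.mem_map_of_mem hz)
  refine ⟨c * u, by simpa using hu, ?_⟩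
  rw [← SimpleGraph.dist_mulCayley_mul_left hS c⁻¹, inv_mul_cancel_left]
  exact hzu

namespace HNNExtension

variable {G : Type*} [Group G] {A B : Subgroup G} {ψ : A ≃* B}

/-- The base group of a hyperbolic HNN-extension is quasiconvex if an associated subgroup is. -/
theorem isQuasiconvexSubgroup_range_of {S : Set (HNNExtension G A B ψ)} (hfin : S.Finite)
    (hS : IsHyperbolicGraph (SimpleGraph.mulCayley S))
    (hB : IsQuasiconvexSubgroup S (B.map (of : G →* HNNExtension G A B ψ))) :
    IsQuasiconvexSubgroup S (of : G →* HNNExtension G A B ψ).range := by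
  obtain ⟨d⟩ := NormalWord.TransversalPair.nonempty G A B
  obtain ⟨F, c, hF, hsep, hnear⟩ := exists_branch_separation (ψ := ψ) d hfin
  obtain ⟨C, hC⟩ := SimpleGraph.exists_dist_mulCayley_le S hF
  obtain ⟨hc, δ, hδ, hX⟩ := SimpleGraph.isHyperbolicGraph_iff.1 hS
  obtain ⟨ε, hε⟩ := hB.exists_dist_coset_le hc
  have hCF : ∀ x, ∀ b ∈ F, (SimpleGraph.mulCayley S).dist x (x * b) ≤ C := fun x b hb => by
    rw [SimpleGraph.dist_mulCayley_mul_right hc]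
    exact hC b hb
  refine ⟨⌊2 * (C : ℝ) + 2 * δ + 2⌋₊ + ε + C, ?_⟩
  rintro _ _ p ⟨g, rfl⟩ ⟨g', rfl⟩ hp z hz
  rcases hbz : branch d z with _ | e
  · exact ⟨z, mem_range_of_branch_eq_none d hbz, by simp⟩
  obtain ⟨k, rfl, hk⟩ := SimpleGraph.Walk.mem_support_iff_exists_getVert.1 hz
  -- Both ends of `p` lie in the base group, hence in no branch, so `p` enters `e` before `z` and
  -- leaves it after `z`.
  obtain ⟨i, hik, b, hb, hib⟩ : ∃ i ≤ k, ∃ b ∈ F, (c e)⁻¹ * (p.getVert i * b) ∈ B.map of := by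
    obtain ⟨i, hik, hi, hi'⟩ := exists_adjacent (P := fun i => ¬branch d (p.getVert i) = some e)
      (Q := fun i => branch d (p.getVert i) = some e) (n := k) (fun i _ => (em _).symm)
      (by simp [branch_of]) hbz
    obtain ⟨l, rfl, hl⟩ := hi'.resolve_left (not_not.2 hi)
    rcases hsep e _ _ (p.adj_getVert_succ (i := l) (by omega)) (by tauto) with h | h
    exacts [⟨l, by omega, h⟩, ⟨l + 1, hik, h⟩]
  obtain ⟨j, hkj, hj, b', hb', hjb⟩ : ∃ j, k ≤ j ∧ j ≤ p.length ∧ ∃ b ∈ F,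
      (c e)⁻¹ * (p.getVert j * b) ∈ B.map of := by
    obtain ⟨i, hik, hi, hi'⟩ := exists_adjacent
      (P := fun i => branch d (p.getVert (k + i)) = some e)
      (Q := fun i => ¬branch d (p.getVert (k + i)) = some e) (n := p.length - k)
      (fun i _ => em _) hbz (by rw [Nat.add_sub_cancel' hk]; simp [branch_of])
    obtain ⟨l, rfl, hl⟩ := hi'.resolve_left hi
    rcases hsep e _ _ (p.adj_getVert_succ (i := k + l) (by omega))
      (by rw [add_assoc]; tauto) with h | h
    exacts [⟨k + l, by omega, by omega, h⟩, ⟨k + l + 1, by omega, by omega, h⟩]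
  obtain ⟨q, hq⟩ := hc.exists_walk_length_eq_dist (p.getVert i * b) (p.getVert j * b')
  let := hc.pathMetric
  have hgeo := (p.isGeodesic hc hp).segment (hik.trans hkj) hj
  obtain ⟨l, -, hl⟩ := hX.exists_dist_le_of_near hgeo (q.isGeodesic hc hq) (C := C)
    (Nat.cast_le.2 (hCF _ b hb)) (Nat.cast_le.2 (hCF _ b' hb')) (i := k - i) (by omega)
  rw [Nat.add_sub_cancel' hik] at hl
  replace hl : (SimpleGraph.mulCayley S).dist (p.getVert k) (q.getVert l) ≤ _ := Nat.le_floor hl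
  obtain ⟨u, hu, hlu⟩ := hε (c e) _ _ q hib hjb hq (q.getVert l) (q.getVert_mem_support l)
  obtain ⟨b'', hb'', hub⟩ := hnear e u hu
  refine ⟨u * b'', hub, hc.dist_triangle.trans (add_le_add ?_ (hCF u b'' hb''))⟩
  exact hc.dist_triangle.trans (add_le_add hl hlu)

end HNNExtension

theorem theorem4 {G : Type*} [Group G] (U V : Subgroup G) (φ : U ≃* V)
    (hH : IsHyperbolicGroup (HNN U V φ))
    (S : Set (HNN U V φ)) (hSfin : S.Finite) (hSgen : Subgroup.closure S = ⊤)
    (hU : IsQuasiconvexSubgroup S (U.map (HNN.base U V φ))) :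
    IsQuasiconvexSubgroup S (HNN.base U V φ).range ∧ IsHyperbolicGroup G := by
  have hS := SimpleGraph.isHyperbolicGraph_mulCayley hH hSfin hSgen
  -- In `HNN U V φ` the subgroup `B` is `U`.
  have hq := HNNExtension.isQuasiconvexSubgroup_range_of hSfin hS hU
  exact ⟨hq, SimpleGraph.isHyperbolicGroup_of_isQuasiconvexSubgroup hSfin hS _
    (HNNExtension.of_injective _) hq⟩
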